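/- Fix integers $m\ge 0$ (number of letters) and $d\ge 0$. Let $\mathcal T$ be the set of non-planar rooted trees with edges decorated by letters of $\{1,\dots,m\}$. The tree product $\odot$ on $\mathcal T$ identifies the roots; its neutral element is the one-node tree, which is denoted by $\emptyset$ and identified with the empty forest. Let $T\subset\mathcal T$ be the set of planted trees (those whose root belongs to exactly one edge), so that $(\mathcal T,\odot)$ is the free commutative monoid on $T$. Let $C$ be the real vector space freely generated by $\mathcal T$, and let $(\hat C,\bullet)$ be the free commutative unital algebra generated by $\mathcal T\setminus\{\emptyset\}$. The monomials of $\hat C$ are the decorated forests, $\bullet$ is the disjoint union, the unit is the empty forest $\emptyset$, and $C\subset\hat C$. The extraction–contraction coproduct of $\hat C$ is $$\hat\Delta\tau=\sum_{\sigma\subseteq\tau}\sigma\otimes\tau/\sigma ,$$ where $\sigma$ runs over all subsets of the set of edges of the forest $\tau$, identified with the corresponding subforest (components without edges being dropped), and $\tau/\sigma$ is obtained by contracting each connected component of $\sigma$ to a node. It restricts to a coaction $\delta:C\to\hat C\otimes C$. Let $\hat\varepsilon(\sigma)=\mathbf 1_{(\sigma=\emptyset)}$ for forests $\sigma$. For linear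 functionals $\alpha,\beta:\hat C\to\mathbb R$ put $\alpha\mathbin{\hat\star}\beta=(\alpha\otimes\beta)\hat\Delta$ and $\psi_\alpha=(\alpha\otimes\mathrm{id})\delta:C\to C$. A character is a unital algebra morphism $\hat C\to\mathbb R$. For a family $\Pi=(\langle\Pi,\tau\rangle)_{\tau\in T}$ in the space $\mathcal C(\mathbb R^d)$ of continuous functions $\mathbb R^d\to\mathbb R$, let $R\Pi$ be the unique family $(\langle R\Pi,\tau\rangle)_{\tau\in\mathcal T}$ that is multiplicative from $(\mathcal T,\odot)$ to $\mathcal C(\mathbb R^d)$ with the pointwise product, satisfies $\langle R\Pi,\emptyset\rangle=1$, and agrees with $\Pi$ on $T$; extend it linearly to $C$. **Theorem 9.1.** Let $X$ be a $\mathcal C(\mathbb R^d)^T$-valued random variable, extended by the convention $\langle X,\emptyset\rangle=1$, such that for all $\tau\in T$ and $x\in\mathbb R^d$ the function $\langle X,\tau\rangle(\cdot+x)$ has the same law as $\langle X,\tau\rangle$, and such that $\langle X,\tau\rangle(0)$ has finite moments of all orders for all $\tau\in T$. Then: 1. $\langle RX,c\rangle(0)$ is integrable for every $c\in C$, and there is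 a unique character $\hat\mu$ on $(\hat C,\bullet)$ with $\hat\mu(\tau)=\mathbb E(\langle RX,\tau\rangle(0))$ for all $\tau\in\mathcal T$. 2. There is a unique linear functional $\hat\mu^{-1}:\hat C\to\mathbb R$ with $\hat\mu^{-1}\mathbin{\hat\star}\hat\mu=\hat\mu\mathbin{\hat\star}\hat\mu^{-1}=\hat\varepsilon$, and it is a character. 3. $\lambda=\hat\mu^{-1}$ is the unique character on $(\hat C,\bullet)$ such that $$\mathbb E\big(\langle RX,\psi_\lambda\tau\rangle(0)\big)=0\qquad\text{for all }\tau\in\mathcal T\setminus\{\emptyset\}.$$ -/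

import Mathlib

open scoped TensorProduct

namespace WickTrees

universe u

/-- Planar rooted trees with edges decorated by letters of `A`. `nil` is the tree with a single node
(its root) and no edge; `graft a t s` is obtained from `s` by attaching to the root of `s` a new first
edge, decorated by `a`, whose upper end is the root of `t`. -/
inductive PTree (A : Type u) : Type u
  | nil : PTree A
  | graft (a : A) (t s : PTree A) : PTree A

namespace PTree

variable {A : Type u}

/-- The type of edges of a planar tree. In `graft a t s`, the edge `none` is the new edge
decorated by `a`, the edges `some (Sum.inl e)` are those of `t`, and `some (Sum.inr e)` those of `s`. -/
def Edge : PTree A → Type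
  | nil => Empty
  | graft _ t s => Option (Edge t ⊕ Edge s)

instance Edge.instFintype : (t : PTree A) → Fintype (Edge t)
  | nil => inferInstanceAs (Fintype Empty)
  | graft _ t s =>
    letI := Edge.instFintype t
    letI := Edge.instFintype s
    inferInstanceAs (Fintype (Option (Edge t ⊕ Edge s)))

instance Edge.instDecidableEq : (t : PTree A) → DecidableEq (Edge t)
  | nil => inferInstanceAs (DecidableEq Empty)
  | graft _ t s =>
    letI := Edge.instDecidableEq t
    letI := Edge.instDecidableEq s
    inferInstanceAs (DecidableEq (Option (Edge t ⊕ Edge s)))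

/-- A subset of the set of edges of `t`, given by its indicator function. -/
abbrev EdgeSet (t : PTree A) : Type := Edge t → Bool

/-- Whether the new edge of `graft a t s` belongs to the subset. -/
def EdgeSet.new {a : A} {t s : PTree A} (σ : EdgeSet (graft a t s)) : Bool := σ none

/-- The part of a subset of edges of `graft a t s` that lies in `t`. -/
def EdgeSet.fst {a : A} {t s : PTree A} (σ : EdgeSet (graft a t s)) : EdgeSet t :=
  fun e => σ (some (Sum.inl e))

/-- The part of a subset of edges of `graft a t s` that lies in `s`. -/
def EdgeSet.snd {a : A} {t s : PTree A} (σ : EdgeSet (graft a t s)) : EdgeSet s :=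
  fun e => σ (some (Sum.inr e))

/-- Identification of the roots of two planar trees. -/
def join : PTree A → PTree A → PTree A
  | nil, r => r
  | graft a t s, r => graft a t (join s r)

/-- The connected component of the root in the subgraph of `t` (on all nodes of `t`) whose edges are
those of `σ`. -/
def rootComponent : (t : PTree A) → EdgeSet t → PTree A
  | nil, _ => nil
  | graft a t s, σ =>
    if σ.new then graft a (rootComponent t σ.fst) (rootComponent s σ.snd)
    else rootComponent s σ.snd

/-- The tree obtained from `t` by contracting every edge of `σ`, that is, by contracting every
connected component of `σ` to a single node. -/
def contract : (t : PTree A) → EdgeSet t → PTree A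
  | nil, _ => nil
  | graft a t s, σ =>
    if σ.new then join (contract t σ.fst) (contract s σ.snd)
    else graft a (contract t σ.fst) (contract s σ.snd)

/-- Two planar trees represent the same non-planar tree: the congruence generated by exchanging
two consecutive branches at a node. -/
inductive Iso : PTree A → PTree A → Prop
  | refl (t : PTree A) : Iso t t
  | symm {t s : PTree A} : Iso t s → Iso s t
  | trans {t s r : PTree A} : Iso t s → Iso s r → Iso t r
  | congr (a : A) {t t' s s' : PTree A} : Iso t t' → Iso s s' → Iso (graft a t s) (graft a t' s')
  | swap (a b : A) (t u s : PTree A) : Iso (graft a t (graft b u s)) (graft b u (graft a t s))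

instance setoid (A : Type u) : Setoid (PTree A) where
  r := Iso
  iseqv := ⟨Iso.refl, Iso.symm, Iso.trans⟩

theorem Iso.join_right {r r' : PTree A} (h : Iso r r') :
    ∀ t : PTree A, Iso (join t r) (join t r')
  | nil => h
  | graft a t s => Iso.congr a (Iso.refl t) (Iso.join_right h s)

theorem Iso.join_left {t t' : PTree A} (h : Iso t t') (r : PTree A) :
    Iso (join t r) (join t' r) := by
  induction h with
  | refl t => exact Iso.refl _
  | symm _ ih => exact ih.symm
  | trans _ _ ih₁ ih₂ => exact ih₁.trans ih₂
  | congr a h₁ _ _ ih₂ => exact Iso.congr a h₁ ih₂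
  | swap a b t u s => exact Iso.swap a b t u _

theorem join_nil : ∀ t : PTree A, join t nil = t
  | nil => rfl
  | graft a t s => congrArg (graft a t) (join_nil s)

theorem join_assoc (s r : PTree A) :
    ∀ t : PTree A, join (join t s) r = join t (join s r)
  | nil => rfl
  | graft a t t' => congrArg (graft a t) (join_assoc s r t')

theorem join_graft_iso (a : A) (u s : PTree A) :
    ∀ t : PTree A, Iso (join t (graft a u s)) (graft a u (join t s))
  | nil => Iso.refl _
  | graft b t t' => (Iso.congr b (Iso.refl t) (join_graft_iso a u s t')).trans (Iso.swap b a t u _)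

theorem join_comm_iso (s : PTree A) : ∀ t : PTree A, Iso (join t s) (join s t)
  | nil => by rw [join_nil]; exact Iso.refl _
  | graft a t t' =>
    (Iso.congr a (Iso.refl t) (join_comm_iso s t')).trans (join_graft_iso a t t' s).symm

end PTree

/-- Non-planar rooted trees with edges decorated by letters of `A`. -/
def RTree (A : Type u) : Type u := Quotient (PTree.setoid A)

namespace RTree

variable {A : Type u}

/-- The non-planar tree represented by a planar tree. -/
def mk (t : PTree A) : RTree A := Quotient.mk (PTree.setoid A) t

theorem mk_eq_mk {t s : PTree A} : mk t = mk s ↔ PTree.Iso t s :=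
  ⟨fun h => Quotient.exact h, fun h => Quotient.sound h⟩

/-- The tree product (identification of the roots); its neutral element is the tree with a single
node, which is identified with the empty forest. -/
instance instCommMonoid : CommMonoid (RTree A) where
  mul := Quotient.map₂ PTree.join fun _ t' h _ _ h' => (h.join_left _).trans (h'.join_right t')
  one := mk PTree.nil
  mul_assoc := by
    rintro ⟨t⟩ ⟨s⟩ ⟨r⟩
    exact congrArg mk (PTree.join_assoc s r t)
  one_mul := by
    rintro ⟨t⟩
    rfl
  mul_one := by
    rintro ⟨t⟩
    exact congrArg mk (PTree.join_nil t)
  mul_comm := by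
    rintro ⟨t⟩ ⟨s⟩
    exact mk_eq_mk.2 (PTree.join_comm_iso s t)

theorem mk_nil : mk (PTree.nil : PTree A) = 1 := rfl

theorem mk_join (t s : PTree A) : mk (PTree.join t s) = mk t * mk s := rfl

/-- The planted tree with trunk decorated by `a`, above which sits the tree `τ`. -/
def plant (a : A) : RTree A → RTree A :=
  Quotient.map (fun t => PTree.graft a t PTree.nil) fun _ _ h => PTree.Iso.congr a h (PTree.Iso.refl _)

theorem mk_graft (a : A) (t s : PTree A) : mk (PTree.graft a t s) = plant a (mk t) * mk s := rfl

/-- A tree is planted if its root belongs to a single edge, the trunk. -/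
def IsPlanted (τ : RTree A) : Prop := ∃ (a : A) (ρ : RTree A), τ = plant a ρ

end RTree

/-- The set of planted trees. -/
abbrev PlantedTree (A : Type u) : Type u := {τ : RTree A // τ.IsPlanted}

/-- The set of trees with at least one edge. -/
abbrev NonemptyTree (A : Type u) : Type u := {τ : RTree A // τ ≠ 1}

/-- The vector space freely generated by the trees. -/
abbrev TreeSpace (A : Type u) : Type u := RTree A →₀ ℝ

/-- The free commutative unital algebra generated by the nonempty trees. Its monomials are the
forests, its product is the disjoint union, and its unit is the empty forest. -/
abbrev ForestAlgebra (A : Type u) : Type u := MvPolynomial (NonemptyTree A) ℝ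

section Coproduct

variable {A : Type u}

open Classical in
/-- A tree as a forest; the tree with a single node is identified with the empty forest. -/
noncomputable def treeForest (τ : RTree A) : ForestAlgebra A :=
  if h : τ = 1 then 1 else MvPolynomial.X ⟨τ, h⟩

/-- The canonical embedding of the tree space in the forest algebra. -/
noncomputable def embed : TreeSpace A →ₗ[ℝ] ForestAlgebra A :=
  Finsupp.linearCombination ℝ treeForest

theorem treeForest_one : treeForest (1 : RTree A) = 1 := by simp [treeForest]

theorem embed_single (τ : RTree A) : embed (Finsupp.single τ 1) = treeForest τ := by
  simp [embed]

namespace PTree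

/-- The connected components that do not contain the root, in the subgraph of `t` (on all nodes
of `t`) whose edges are those of `σ`. Each one is rooted at its node closest to the root of `t`. -/
def otherComponents : (t : PTree A) → EdgeSet t → Multiset (RTree A)
  | nil, _ => 0
  | graft _ t s, σ =>
    (if σ.new then 0 else {RTree.mk (rootComponent t σ.fst)}) +
      (otherComponents t σ.fst + otherComponents s σ.snd)

/-- All connected components of the subgraph of `t` whose edges are those of `σ`, including those
which are reduced to a node. -/
def components (t : PTree A) (σ : EdgeSet t) : Multiset (RTree A) :=
  RTree.mk (rootComponent t σ) ::ₘ otherComponents t σ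

/-- The subforest of `t` determined by the subset `σ` of edges: the disjoint union of the
connected components, those without edges being dropped. -/
noncomputable def subforest (t : PTree A) (σ : EdgeSet t) : ForestAlgebra A :=
  ((components t σ).map treeForest).prod

/-- The sum over all subsets `σ` of edges of the tensor products `σ ⊗ t / σ`. -/
noncomputable def extract (t : PTree A) : ForestAlgebra A ⊗[ℝ] TreeSpace A :=
  ∑ σ : EdgeSet t, subforest t σ ⊗ₜ[ℝ] Finsupp.single (RTree.mk (contract t σ)) (1 : ℝ)

/-- Exchange of branches induces a bijection of edges compatible with extraction and contraction. -/
theorem Iso.exists_edge_equiv {t t' : PTree A} (h : Iso t t') :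
    ∃ f : Edge t ≃ Edge t', ∀ σ : EdgeSet t',
      Iso (rootComponent t fun e => σ (f e)) (rootComponent t' σ) ∧
      otherComponents t (fun e => σ (f e)) = otherComponents t' σ ∧
      Iso (contract t fun e => σ (f e)) (contract t' σ) := by
  induction h with
  | refl t => exact ⟨Equiv.refl _, fun σ => ⟨Iso.refl _, rfl, Iso.refl _⟩⟩
  | symm _ ih =>
    obtain ⟨f, hf⟩ := ih
    refine ⟨f.symm, fun σ => ?_⟩
    have := hf fun e => σ (f.symm e)
    simp only [Equiv.symm_apply_apply] at this
    exact ⟨this.1.symm, this.2.1.symm, this.2.2.symm⟩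
  | trans _ _ ih₁ ih₂ =>
    obtain ⟨f, hf⟩ := ih₁
    obtain ⟨g, hg⟩ := ih₂
    refine ⟨f.trans g, fun σ => ?_⟩
    have h₁ := hf fun e => σ (g e)
    have h₂ := hg σ
    exact ⟨h₁.1.trans h₂.1, h₁.2.1.trans h₂.2.1, h₁.2.2.trans h₂.2.2⟩
  | @congr a t t' s s' _ _ ih₁ ih₂ =>
    obtain ⟨f, hf⟩ := ih₁
    obtain ⟨g, hg⟩ := ih₂
    refine ⟨Equiv.optionCongr (Equiv.sumCongr f g), fun σ => ?_⟩
    have h₁ := hf (EdgeSet.fst σ)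
    have h₂ := hg (EdgeSet.snd σ)
    suffices key : ∀ τ : EdgeSet (graft a t s), τ.new = EdgeSet.new σ →
        τ.fst = (fun e => EdgeSet.fst σ (f e)) → τ.snd = (fun e => EdgeSet.snd σ (g e)) →
        Iso (rootComponent _ τ) (rootComponent _ σ) ∧ otherComponents _ τ = otherComponents _ σ ∧
          Iso (contract _ τ) (contract _ σ) from key _ rfl rfl rfl
    intro τ e₁ e₂ e₃
    simp only [rootComponent, otherComponents, contract, e₁, e₂, e₃]
    cases EdgeSet.new σ
    · simp only [Bool.false_eq_true, if_false]
      refine ⟨h₂.1, ?_, Iso.congr a h₁.2.2 h₂.2.2⟩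
      rw [h₁.2.1, h₂.2.1, RTree.mk_eq_mk.2 h₁.1]
    · simp only [if_true]
      refine ⟨Iso.congr a h₁.1 h₂.1, ?_, (h₁.2.2.join_left _).trans (h₂.2.2.join_right _)⟩
      rw [h₁.2.1, h₂.2.1]
  | swap a b t u s =>
    let F : Option (Edge t ⊕ Option (Edge u ⊕ Edge s)) → Option (Edge u ⊕ Option (Edge t ⊕ Edge s))
      | none => some (Sum.inr none)
      | some (Sum.inl e) => some (Sum.inr (some (Sum.inl e)))
      | some (Sum.inr none) => none
      | some (Sum.inr (some (Sum.inl e))) => some (Sum.inl e)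
      | some (Sum.inr (some (Sum.inr e))) => some (Sum.inr (some (Sum.inr e)))
    let G : Option (Edge u ⊕ Option (Edge t ⊕ Edge s)) → Option (Edge t ⊕ Option (Edge u ⊕ Edge s))
      | none => some (Sum.inr none)
      | some (Sum.inl e) => some (Sum.inr (some (Sum.inl e)))
      | some (Sum.inr none) => none
      | some (Sum.inr (some (Sum.inl e))) => some (Sum.inl e)
      | some (Sum.inr (some (Sum.inr e))) => some (Sum.inr (some (Sum.inr e)))
    have hGF : Function.LeftInverse G F := by rintro (_ | _ | _ | _ | _) <;> rfl
    have hFG : Function.RightInverse G F := by rintro (_ | _ | _ | _ | _) <;> rfl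
    refine ⟨⟨F, G, hGF, hFG⟩, fun σ => ?_⟩
    suffices key : ∀ τ : EdgeSet (graft a t (graft b u s)), τ.new = (EdgeSet.snd σ).new →
        τ.fst = (EdgeSet.snd σ).fst → τ.snd.new = EdgeSet.new σ → τ.snd.fst = EdgeSet.fst σ →
        τ.snd.snd = (EdgeSet.snd σ).snd →
        Iso (rootComponent _ τ) (rootComponent _ σ) ∧ otherComponents _ τ = otherComponents _ σ ∧
          Iso (contract _ τ) (contract _ σ) from key _ rfl rfl rfl rfl rfl
    intro τ e₁ e₂ e₃ e₄ e₅
    simp only [rootComponent, otherComponents, contract, e₁, e₂, e₃, e₄, e₅]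
    refine ⟨?_, by ac_rfl, ?_⟩
    · cases EdgeSet.new σ <;> cases (EdgeSet.snd σ).new <;>
        first | exact Iso.refl _ | exact Iso.swap a b _ _ _
    · cases EdgeSet.new σ <;> cases (EdgeSet.snd σ).new <;>
        simp only [Bool.false_eq_true, if_false, if_true]
      · exact Iso.swap a b _ _ _
      · exact join_graft_iso _ _ _ _
      · exact (join_graft_iso _ _ _ _).symm
      · rw [← join_assoc, ← join_assoc]
        exact (join_comm_iso _ _).join_left _

theorem extract_eq_of_iso {t t' : PTree A} (h : Iso t t') : extract t = extract t' := by
  obtain ⟨f, hf⟩ := h.exists_edge_equiv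
  refine (Fintype.sum_equiv (f.symm.arrowCongr (Equiv.refl Bool)) _ _ fun σ => ?_).symm
  obtain ⟨h₁, h₂, h₃⟩ := hf σ
  change _ = subforest t (fun e => σ (f e)) ⊗ₜ[ℝ]
    Finsupp.single (RTree.mk (contract t fun e => σ (f e))) (1 : ℝ)
  simp only [subforest, components]
  rw [RTree.mk_eq_mk.2 h₁, h₂, RTree.mk_eq_mk.2 h₃]

end PTree

/-- The extraction-contraction of a non-planar tree. -/
noncomputable def RTree.extract : RTree A → ForestAlgebra A ⊗[ℝ] TreeSpace A :=
  Quotient.lift PTree.extract fun _ _ h => PTree.extract_eq_of_iso h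

/-- The coaction of the forest algebra on the tree space. -/
noncomputable def coaction : TreeSpace A →ₗ[ℝ] ForestAlgebra A ⊗[ℝ] TreeSpace A :=
  Finsupp.linearCombination ℝ RTree.extract

/-- The extraction-contraction coproduct on the forest algebra. On a tree it is the sum over all
subforests `σ` of `σ ⊗ τ / σ`; on a disjoint union of trees, whose subsets of edges are the disjoint
unions of subsets of edges of the components, it is the product. -/
noncomputable def coproduct : ForestAlgebra A →ₐ[ℝ] ForestAlgebra A ⊗[ℝ] ForestAlgebra A :=
  MvPolynomial.aeval fun τ : NonemptyTree A => (embed.lTensor (ForestAlgebra A)) τ.1.extract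

theorem coproduct_treeForest (t : PTree A) :
    coproduct (treeForest (RTree.mk t)) =
      ∑ σ : t.EdgeSet, t.subforest σ ⊗ₜ[ℝ] treeForest (RTree.mk (t.contract σ)) := by
  have key : ∀ s : PTree A, (embed.lTensor (ForestAlgebra A)) (RTree.mk s).extract =
      ∑ σ : s.EdgeSet, s.subforest σ ⊗ₜ[ℝ] treeForest (RTree.mk (s.contract σ)) := by
    intro s
    change (embed.lTensor (ForestAlgebra A)) s.extract = _
    simp [PTree.extract, embed_single]
  by_cases h : RTree.mk t = 1
  · have h' : (RTree.mk t).extract = (RTree.mk (PTree.nil : PTree A)).extract := by rw [h]; rfl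
    rw [← key, h', key, h, treeForest_one, map_one]
    change _ = ∑ σ : Empty → Bool, _
    rw [Fintype.sum_unique]
    simp [PTree.subforest, PTree.components, PTree.rootComponent, PTree.otherComponents,
      PTree.contract, RTree.mk_nil, treeForest_one, Algebra.TensorProduct.one_def]
  · rw [← key, treeForest, dif_neg h, coproduct, MvPolynomial.aeval_X]

/-- On a forest, the coproduct is the sum over all subsets of edges of the forest. -/
theorem coproduct_forest {n : ℕ} (t : Fin n → PTree A) :
    coproduct (∏ i, treeForest (RTree.mk (t i))) =
      ∑ σ : (i : Fin n) → (t i).EdgeSet,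
        (∏ i, (t i).subforest (σ i)) ⊗ₜ[ℝ] ∏ i, treeForest (RTree.mk ((t i).contract (σ i))) := by
  have tmul_prod : ∀ (s : Finset (Fin n)) (f g : Fin n → ForestAlgebra A),
      ∏ i ∈ s, (f i ⊗ₜ[ℝ] g i) = (∏ i ∈ s, f i) ⊗ₜ[ℝ] ∏ i ∈ s, g i := by
    intro s f g
    induction s using Finset.cons_induction with
    | empty => rfl
    | cons i s hi ih => simp only [Finset.prod_cons, ih, Algebra.TensorProduct.tmul_mul_tmul]
  rw [map_prod]
  simp only [coproduct_treeForest, Finset.prod_univ_sum, tmul_prod, Fintype.piFinset_univ]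

/-- The counit, equal to `1` on the empty forest and to `0` on all other forests. -/
noncomputable def counit : ForestAlgebra A →ₐ[ℝ] ℝ := MvPolynomial.aeval fun _ => 0

/-- The convolution product of linear functionals on the forest algebra. -/
noncomputable def conv (α β : ForestAlgebra A →ₗ[ℝ] ℝ) : ForestAlgebra A →ₗ[ℝ] ℝ :=
  LinearMap.mul' ℝ ℝ ∘ₗ TensorProduct.map α β ∘ₗ coproduct.toLinearMap

/-- `α` and `β` are inverse to each other for the convolution product. -/
def IsConvInverse (α β : ForestAlgebra A →ₗ[ℝ] ℝ) : Prop :=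
  conv α β = counit.toLinearMap ∧ conv β α = counit.toLinearMap

/-- The operator `(α ⊗ id) δ` on the tree space, where `δ` is the coaction. -/
noncomputable def psi (α : ForestAlgebra A →ₗ[ℝ] ℝ) : TreeSpace A →ₗ[ℝ] TreeSpace A :=
  (TensorProduct.lid ℝ (TreeSpace A)).toLinearMap ∘ₗ α.rTensor (TreeSpace A) ∘ₗ coaction

end Coproduct

section Lift

variable {A : Type u}

/-- `ℝ ^ d`. -/
abbrev Space (d : ℕ) : Type := EuclideanSpace ℝ (Fin d)

/-- The Borel σ-algebra of the topology of locally uniform convergence. -/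
instance instMeasurableSpaceC (d : ℕ) : MeasurableSpace C(Space d, ℝ) := borel _

instance instBorelSpaceC (d : ℕ) : BorelSpace C(Space d, ℝ) := ⟨rfl⟩

/-- The shifted function `f (· + x)`. -/
def shift {d : ℕ} (x : Space d) (f : C(Space d, ℝ)) : C(Space d, ℝ) :=
  f.comp ⟨fun y => y + x, by fun_prop⟩

/-- The product of `Φ` over the planted trees which make up a planar tree. -/
def PTree.lift {d : ℕ} (Φ : PlantedTree A → C(Space d, ℝ)) : PTree A → C(Space d, ℝ)
  | PTree.nil => 1
  | PTree.graft a t s => Φ ⟨RTree.plant a (RTree.mk t), a, RTree.mk t, rfl⟩ * PTree.lift Φ s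

theorem PTree.lift_eq_of_iso {d : ℕ} (Φ : PlantedTree A → C(Space d, ℝ)) {t t' : PTree A}
    (h : PTree.Iso t t') : PTree.lift Φ t = PTree.lift Φ t' := by
  induction h with
  | refl t => rfl
  | symm _ ih => exact ih.symm
  | trans _ _ ih₁ ih₂ => exact ih₁.trans ih₂
  | congr a h₁ _ _ ih₂ => simp only [PTree.lift, ih₂, RTree.mk_eq_mk.2 h₁]
  | swap a b t u s => exact mul_left_comm _ _ _

theorem PTree.lift_join {d : ℕ} (Φ : PlantedTree A → C(Space d, ℝ)) (s : PTree A) :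
    ∀ t : PTree A, PTree.lift Φ (PTree.join t s) = PTree.lift Φ t * PTree.lift Φ s
  | PTree.nil => (one_mul _).symm
  | PTree.graft a t t' => by
    simp only [PTree.lift, PTree.join, PTree.lift_join Φ s t', mul_assoc]

/-- The canonical lift of a family of functions indexed by planted trees: the character on
trees, for the tree product and the pointwise product, which extends it. -/
def canonicalLift {d : ℕ} (Φ : PlantedTree A → C(Space d, ℝ)) : RTree A →* C(Space d, ℝ) where
  toFun := Quotient.lift (PTree.lift Φ) fun _ _ h => PTree.lift_eq_of_iso Φ h
  map_one' := rfl
  map_mul' := by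
    rintro ⟨t⟩ ⟨s⟩
    exact PTree.lift_join Φ s t

theorem canonicalLift_planted {d : ℕ} (Φ : PlantedTree A → C(Space d, ℝ)) (τ : PlantedTree A) :
    canonicalLift Φ τ.1 = Φ τ := by
  obtain ⟨_, a, ⟨t⟩, rfl⟩ := τ
  exact mul_one _

/-- The canonical lift is the only character which extends the given family. -/
theorem canonicalLift_unique {d : ℕ} (Φ : PlantedTree A → C(Space d, ℝ))
    (Γ : RTree A →* C(Space d, ℝ)) (h : ∀ τ : PlantedTree A, Γ τ.1 = Φ τ) :
    Γ = canonicalLift Φ := by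
  have key : ∀ t : PTree A, Γ (RTree.mk t) = canonicalLift Φ (RTree.mk t) := by
    intro t
    induction t with
    | nil => rw [RTree.mk_nil, map_one, map_one]
    | graft a t s _ ih =>
      rw [RTree.mk_graft, map_mul, map_mul, ih]
      congr 1
      exact (h ⟨_, a, RTree.mk t, rfl⟩).trans (canonicalLift_planted Φ ⟨_, a, RTree.mk t, rfl⟩).symm
  ext1 τ
  obtain ⟨t⟩ := τ
  exact key t

/-- The linear extension of the canonical lift to the tree space. -/
noncomputable def liftC {d : ℕ} (Φ : PlantedTree A → C(Space d, ℝ)) :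
    TreeSpace A →ₗ[ℝ] C(Space d, ℝ) :=
  Finsupp.linearCombination ℝ (canonicalLift Φ)

end Lift

section Probability

open MeasureTheory

variable {A : Type u} {d : ℕ} {Ω : Type*} [MeasurableSpace Ω]

/-- Every function `X τ (· + x)` has the same law as `X τ`. -/
def IsStationaryFamily (X : Ω → PlantedTree A → C(Space d, ℝ)) (P : Measure Ω) : Prop :=
  ∀ (x : Space d) (τ : PlantedTree A),
    ProbabilityTheory.IdentDistrib (fun ω => shift x (X ω τ)) (fun ω => X ω τ) P P

/-- Every random variable `X τ 0` has finite moments of all orders. -/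
def HasFiniteMoments (X : Ω → PlantedTree A → C(Space d, ℝ)) (P : Measure Ω) : Prop :=
  ∀ (τ : PlantedTree A) (p : ℕ), Integrable (fun ω => |X ω τ 0| ^ p) P

/-- The linear functional on the tree space which maps a tree `τ` to the expectation of the
canonical lift of `X` on `τ` at `0`. -/
noncomputable def mean (X : Ω → PlantedTree A → C(Space d, ℝ)) (P : Measure Ω) :
    TreeSpace A →ₗ[ℝ] ℝ :=
  Finsupp.linearCombination ℝ fun τ => ∫ ω, canonicalLift (X ω) τ 0 ∂P

/-- The character on the forest algebra with the values of `mean X P` on nonempty trees. -/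
noncomputable def meanChar (X : Ω → PlantedTree A → C(Space d, ℝ)) (P : Measure Ω) :
    ForestAlgebra A →ₐ[ℝ] ℝ :=
  MvPolynomial.aeval fun τ : NonemptyTree A => mean X P (Finsupp.single τ.1 1)

end Probability

end WickTrees

open MeasureTheory WickTrees

/-!
The extraction-contraction coproduct makes the forest algebra a commutative bialgebra:
coassociativity says that a pair of nested sets of edges `ρ ⊆ σ` of a tree is the same as a set `ρ`
together with a set of edges of the tree contracted along `ρ`. Contracting at least one edge lowers
the number of edges, so that an antipode can be defined by recursion. Characters therefore form a
group under convolution. Since `E ⟨RX, c⟩(0) = μ c` for the character `μ` of moments, the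
expectation `E ⟨RX, ψ_λ τ⟩(0)` is `(λ ⋆ μ) τ`, and it vanishes for all nonempty trees exactly when
`λ ⋆ μ` is the counit, that is when `λ = μ⁻¹`.
-/

namespace WickTrees

universe u v

namespace PTree

variable {A : Type u} {B : Type v}

/-- The number of edges of a planar tree. -/
def size : PTree A → ℕ
  | nil => 0
  | graft _ t s => size t + size s + 1

theorem size_join (s : PTree A) : ∀ t : PTree A, size (join t s) = size t + size s
  | nil => (Nat.zero_add _).symm
  | graft a t t' => by simp only [join, size, size_join s t']; omega

theorem size_eq_zero_iff {t : PTree A} : size t = 0 ↔ t = nil := by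
  cases t <;> simp [size]

theorem Iso.size_eq {t s : PTree A} (h : Iso t s) : size t = size s := by
  induction h with
  | refl t => rfl
  | symm _ ih => exact ih.symm
  | trans _ _ ih₁ ih₂ => exact ih₁.trans ih₂
  | congr a _ _ ih₁ ih₂ => simp only [size, ih₁, ih₂]
  | swap a b t u s => simp only [size]; omega

theorem join_eq_nil_iff {t s : PTree A} : join t s = nil ↔ t = nil ∧ s = nil := by
  cases t <;> simp [join]

/-- A subset of edges of `graft a t s` amounts to a truth value for the new edge, a subset of edges
of `t` and a subset of edges of `s`. -/
def graftEquiv (a : A) (t s : PTree A) :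
    EdgeSet (graft a t s) ≃ Bool × EdgeSet t × EdgeSet s where
  toFun σ := (σ.new, σ.fst, σ.snd)
  invFun p := fun e => match e with
    | none => p.1
    | some (Sum.inl e) => p.2.1 e
    | some (Sum.inr e) => p.2.2 e
  left_inv σ := by funext e; rcases e with _ | e | e <;> rfl
  right_inv _ := rfl

theorem edgeSet_graft_ext_iff {a : A} {t s : PTree A} {σ ρ : EdgeSet (graft a t s)} :
    σ = ρ ↔ σ.new = ρ.new ∧ σ.fst = ρ.fst ∧ σ.snd = ρ.snd := by
  rw [← (graftEquiv a t s).injective.eq_iff]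
  exact Prod.ext_iff.trans (and_congr_right' Prod.ext_iff)

theorem edgeSet_graft_ne_bot_iff {a : A} {t s : PTree A} {σ : EdgeSet (graft a t s)} :
    σ ≠ ⊥ ↔ σ.new = true ∨ σ.fst ≠ ⊥ ∨ σ.snd ≠ ⊥ := by
  rw [Ne, edgeSet_graft_ext_iff, not_and_or, not_and_or]
  exact or_congr_left (iff_of_eq (Bool.not_eq_false _))

theorem contract_bot : ∀ t : PTree A, contract t ⊥ = t
  | nil => rfl
  | graft a t s => congrArg₂ (graft a) (contract_bot t) (contract_bot s)

theorem rootComponent_top : ∀ t : PTree A, rootComponent t ⊤ = t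
  | nil => rfl
  | graft a t s => congrArg₂ (graft a) (rootComponent_top t) (rootComponent_top s)

theorem otherComponents_top : ∀ t : PTree A, otherComponents t ⊤ = 0
  | nil => rfl
  | graft a t s => by
    change 0 + (otherComponents t ⊤ + otherComponents s ⊤) = 0
    simp only [otherComponents_top, add_zero]

theorem contract_eq_nil_iff : ∀ {t : PTree A} {σ : EdgeSet t}, contract t σ = nil ↔ σ = ⊤
  | nil, σ => iff_of_true rfl (funext fun e => nomatch e)
  | graft a t s, σ => by
    rw [edgeSet_graft_ext_iff]
    change _ ↔ σ.new = true ∧ σ.fst = ⊤ ∧ σ.snd = ⊤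
    rw [contract, ← contract_eq_nil_iff, ← contract_eq_nil_iff]
    cases σ.new <;> simp [join_eq_nil_iff]

theorem size_contract_le : ∀ {t : PTree A} (σ : EdgeSet t), size (contract t σ) ≤ size t
  | nil, _ => le_rfl
  | graft a t s, σ => by
    have ht := size_contract_le σ.fst
    have hs := size_contract_le σ.snd
    rw [contract]
    split_ifs <;> simp only [size, size_join] <;> omega

theorem size_contract_lt : ∀ {t : PTree A} {σ : EdgeSet t}, σ ≠ ⊥ → size (contract t σ) < size t
  | nil, _, h => absurd (funext fun e => nomatch e) h
  | graft a t s, σ, h => by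
    have ht := size_contract_le σ.fst
    have hs := size_contract_le σ.snd
    rcases edgeSet_graft_ne_bot_iff.1 h with hnew | hfst | hsnd
    · simp only [contract, hnew, if_true, size, size_join]
      omega
    · have := size_contract_lt hfst
      rw [contract]
      split_ifs <;> simp only [size, size_join] <;> omega
    · have := size_contract_lt hsnd
      rw [contract]
      split_ifs <;> simp only [size, size_join] <;> omega

end PTree

namespace RTree

variable {A : Type u}

/-- The number of edges of a non-planar tree. -/
def size : RTree A → ℕ := Quotient.lift PTree.size fun _ _ h => h.size_eq

theorem mk_eq_one_iff {t : PTree A} : mk t = 1 ↔ t = PTree.nil :=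
  ⟨fun h => PTree.size_eq_zero_iff.1 (mk_eq_mk.1 h).size_eq, congrArg mk⟩

end RTree

section Forest

variable {A : Type u}

theorem treeForest_of_ne_one {τ : RTree A} (h : τ ≠ 1) : treeForest τ = MvPolynomial.X ⟨τ, h⟩ :=
  dif_neg h

theorem counit_treeForest_of_ne_one {τ : RTree A} (h : τ ≠ 1) : counit (treeForest τ) = 0 := by
  rw [treeForest_of_ne_one h, counit, MvPolynomial.aeval_X]

theorem algHom_ext_treeForest {B : Type*} [CommSemiring B] [Algebra ℝ B]
    {α β : ForestAlgebra A →ₐ[ℝ] B}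
    (h : ∀ t : PTree A, α (treeForest (RTree.mk t)) = β (treeForest (RTree.mk t))) : α = β := by
  refine MvPolynomial.algHom_ext ?_
  rintro ⟨⟨t⟩, ht⟩
  have := h t
  rwa [treeForest_of_ne_one (show RTree.mk t ≠ 1 from ht)] at this

theorem aeval_treeForest {B : Type*} [CommSemiring B] [Algebra ℝ B] {f : RTree A → B}
    (hf : f 1 = 1) (τ : RTree A) :
    MvPolynomial.aeval (fun τ : NonemptyTree A => f τ.1) (treeForest τ) = f τ := by
  by_cases h : τ = 1
  · rw [h, treeForest_one, map_one, hf]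
  · rw [treeForest_of_ne_one h, MvPolynomial.aeval_X]

namespace PTree

theorem subforest_top (t : PTree A) : subforest t ⊤ = treeForest (RTree.mk t) := by
  simp [subforest, components, rootComponent_top, otherComponents_top]

theorem subforest_graft_of_new_eq_false {a : A} {t s : PTree A} {σ : EdgeSet (graft a t s)}
    (h : σ.new = false) : subforest (graft a t s) σ = subforest t σ.fst * subforest s σ.snd := by
  simp only [subforest, components, rootComponent, otherComponents, h, Bool.false_eq_true, if_false,
    Multiset.map_cons, Multiset.prod_cons, Multiset.map_add, Multiset.prod_add,
    Multiset.map_singleton, Multiset.prod_singleton]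
  ring

theorem subforest_bot : ∀ t : PTree A, subforest t ⊥ = 1
  | nil => by simp [subforest, components, rootComponent, otherComponents, RTree.mk_nil,
      treeForest_one]
  | graft a t s => by
    rw [subforest_graft_of_new_eq_false rfl]
    change subforest t ⊥ * subforest s ⊥ = 1
    rw [subforest_bot, subforest_bot, one_mul]

theorem counit_subforest_of_ne_bot :
    ∀ {t : PTree A} {σ : EdgeSet t}, σ ≠ ⊥ → counit (subforest t σ) = 0
  | nil, _, h => absurd (funext fun e => nomatch e) h
  | graft a t s, σ, h => by
    rcases hnew : σ.new with _ | _
    · rw [subforest_graft_of_new_eq_false hnew, map_mul]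
      rcases edgeSet_graft_ne_bot_iff.1 h with hnew' | hfst | hsnd
      · simp [hnew] at hnew'
      · rw [counit_subforest_of_ne_bot hfst, zero_mul]
      · rw [counit_subforest_of_ne_bot hsnd, mul_zero]
    · rw [subforest, components, rootComponent, if_pos hnew, Multiset.map_cons, Multiset.prod_cons,
        map_mul, counit_treeForest_of_ne_one, zero_mul]
      exact RTree.mk_eq_one_iff.not.2 nofun

end PTree

end Forest

namespace PTree

variable {A : Type u} {B : Type v} [CommSemiring B]

/-- The sum of `f r c` over all subsets of edges of a planar tree, where `r` is the component of the
root and `c` the contracted tree, each term being weighted by the product of `w` over the other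
components. Keeping `r` as an argument of `f` is what makes recursion on the tree possible. -/
def extractionSum (w : RTree A → B) (t : PTree A) (f : PTree A → PTree A → B) : B :=
  ∑ σ : EdgeSet t, ((otherComponents t σ).map w).prod * f (rootComponent t σ) (contract t σ)

theorem extractionSum_nil (w : RTree A → B) (f : PTree A → PTree A → B) :
    extractionSum w nil f = f nil nil := by
  change ∑ σ : Empty → Bool, _ = _
  simp [otherComponents, rootComponent, contract]

theorem extractionSum_graft (w : RTree A → B) (a : A) (t s : PTree A) (f : PTree A → PTree A → B) :
    extractionSum w (graft a t s) f =
      extractionSum w t fun r c => extractionSum w s fun r' c' =>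
        f (graft a r r') (join c c') + w (RTree.mk r) * f r' (graft a c c') := by
  unfold extractionSum
  rw [← (graftEquiv a t s).symm.sum_comp, Fintype.sum_prod_type, Fintype.sum_bool,
    ← Finset.sum_add_distrib, Fintype.sum_prod_type]
  refine Finset.sum_congr rfl fun σ _ => ?_
  rw [Finset.mul_sum]
  refine Finset.sum_congr rfl fun ρ _ => ?_
  have hnew (b : Bool) : ((graftEquiv a t s).symm (b, σ, ρ)).new = b := rfl
  have hfst (b : Bool) : ((graftEquiv a t s).symm (b, σ, ρ)).fst = σ := rfl
  have hsnd (b : Bool) : ((graftEquiv a t s).symm (b, σ, ρ)).snd = ρ := rfl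
  simp only [otherComponents, rootComponent, contract, hnew, hfst, hsnd, if_true,
    Bool.false_eq_true, if_false, Multiset.map_add, Multiset.prod_add, Multiset.map_singleton,
    Multiset.prod_singleton, zero_add]
  ring

theorem extractionSum_add (w : RTree A → B) (t : PTree A) (f g : PTree A → PTree A → B) :
    (extractionSum w t fun r c => f r c + g r c) = extractionSum w t f + extractionSum w t g := by
  simp only [extractionSum, mul_add, Finset.sum_add_distrib]

theorem mul_extractionSum (w : RTree A → B) (t : PTree A) (b : B) (f : PTree A → PTree A → B) :
    b * extractionSum w t f = extractionSum w t fun r c => b * f r c := by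
  simp only [extractionSum, Finset.mul_sum, mul_left_comm]

theorem extractionSum_mul (w : RTree A → B) (t : PTree A) (b : B) (f : PTree A → PTree A → B) :
    extractionSum w t f * b = extractionSum w t fun r c => f r c * b := by
  simp only [extractionSum, Finset.sum_mul, mul_assoc]

theorem extractionSum_comm (w w' : RTree A → B) (t s : PTree A)
    (f : PTree A → PTree A → PTree A → PTree A → B) :
    (extractionSum w t fun r c => extractionSum w' s fun r' c' => f r c r' c') =
      extractionSum w' s fun r' c' => extractionSum w t fun r c => f r c r' c' := by
  simp only [extractionSum, Finset.mul_sum]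
  rw [Finset.sum_comm]
  simp only [mul_left_comm]

theorem extractionSum_join (w : RTree A → B) (t s : PTree A) (f : PTree A → PTree A → B) :
    extractionSum w (join t s) f =
      extractionSum w t fun r c => extractionSum w s fun r' c' => f (join r r') (join c c') := by
  induction t generalizing f with
  | nil => rw [extractionSum_nil]; rfl
  | graft a t t' _ ih =>
    simp only [join, extractionSum_graft, ih, join_assoc, extractionSum_add, mul_extractionSum]

section Assoc

variable (x y : RTree A → B) (a : A) (g : PTree A → PTree A → PTree A → B)

/-- The summand of a double extraction from `graft a t s`. The indices `p₁, q₁, c₁` refer to `t` and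
`p₂, q₂, c₂` to `s`: the first extracted part, the second one, and what is left after contraction.
The three terms correspond to the new edge being extracted first, second, or not at all. -/
def doubleGraft (p₁ q₁ c₁ p₂ q₂ c₂ : PTree A) : B :=
  g (graft a p₁ p₂) (join q₁ q₂) (join c₁ c₂) +
    x (RTree.mk p₁) * (g p₂ (graft a q₁ q₂) (join c₁ c₂) +
      y (RTree.mk q₁) * g p₂ q₂ (graft a c₁ c₂))

theorem extractionSum_rootComponent_graft {z : RTree A → B}
    (hz : ∀ t : PTree A,
      z (RTree.mk t) = extractionSum x t fun r c => x (RTree.mk r) * y (RTree.mk c))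
    (t s : PTree A) :
    (extractionSum z (graft a t s) fun r c => extractionSum x r fun p q => g p q c) =
      extractionSum z t fun r₁ c₁ => extractionSum x r₁ fun p₁ q₁ =>
        extractionSum z s fun r₂ c₂ => extractionSum x r₂ fun p₂ q₂ =>
          doubleGraft x y a g p₁ q₁ c₁ p₂ q₂ c₂ := by
  rw [extractionSum_graft]
  congr! 3 with r₁ c₁
  rw [extractionSum_comm]
  congr! 3 with r₂ c₂
  rw [extractionSum_graft, hz, extractionSum_mul, ← extractionSum_add]
  congr! 3 with p₁ q₁
  rw [mul_extractionSum, ← extractionSum_add]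
  congr! 3 with p₂ q₂
  rw [doubleGraft]
  ring

theorem extractionSum_contract_graft (t s : PTree A) :
    (extractionSum x (graft a t s) fun p c' => extractionSum y c' fun q c => g p q c) =
      extractionSum x t fun p₁ c₁' => extractionSum y c₁' fun q₁ c₁ =>
        extractionSum x s fun p₂ c₂' => extractionSum y c₂' fun q₂ c₂ =>
          doubleGraft x y a g p₁ q₁ c₁ p₂ q₂ c₂ := by
  rw [extractionSum_graft]
  congr! 3 with p₁ c₁'
  rw [extractionSum_comm]
  congr! 3 with p₂ c₂'
  rw [extractionSum_join, extractionSum_graft, mul_extractionSum, ← extractionSum_add]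
  congr! 3 with q₁ c₁
  rw [mul_extractionSum, ← extractionSum_add]
  rfl

/-- With `z` the convolution of `x` and `y`, the left side is a sum over pairs `ρ ⊆ σ` of sets of
edges, which become the pairs `(ρ, σ / ρ)` of a subset and a subset of the contracted tree on the
right side. -/
theorem extractionSum_assoc {z : RTree A → B}
    (hz : ∀ t : PTree A,
      z (RTree.mk t) = extractionSum x t fun r c => x (RTree.mk r) * y (RTree.mk c))
    (t : PTree A) :
    (extractionSum z t fun r c => extractionSum x r fun p q => g p q c) =
      extractionSum x t fun p c' => extractionSum y c' fun q c => g p q c := by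
  induction t generalizing g with
  | nil => simp only [extractionSum_nil]
  | graft a t s iht ihs =>
    rw [extractionSum_rootComponent_graft x y a g hz, extractionSum_contract_graft, ← iht]
    simp only [ihs]

end Assoc

end PTree

section

open Algebra.TensorProduct

variable {R F : Type*} [CommSemiring R] [CommSemiring F] [Algebra R F]

/-- The hypothesis `h` is the associativity of the convolution product of the three inclusions of
`F` in `F ⊗[R] (F ⊗[R] F)`. -/
theorem coassoc_of_productMap_assoc (Δ : F →ₐ[R] F ⊗[R] F)
    (h : (productMap ((productMap (includeLeft : F →ₐ[R] F ⊗[R] (F ⊗[R] F))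
          (includeRight.comp includeLeft)).comp Δ) (includeRight.comp includeRight)).comp Δ =
      (productMap includeLeft ((productMap (includeRight.comp includeLeft)
        (includeRight.comp includeRight)).comp Δ)).comp Δ) :
    (Algebra.TensorProduct.assoc R R R F F F).toAlgHom.comp
        ((Algebra.TensorProduct.map Δ (.id R F)).comp Δ) =
      (Algebra.TensorProduct.map (.id R F) Δ).comp Δ := by
  have h₁₂ (z : F ⊗[R] F) (v : F) : productMap (includeLeft : F →ₐ[R] F ⊗[R] (F ⊗[R] F))
      (includeRight.comp includeLeft) z * (1 ⊗ₜ[R] (1 ⊗ₜ[R] v)) =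
        Algebra.TensorProduct.assoc R R R F F F (z ⊗ₜ[R] v) := by
    induction z with
    | zero => simp
    | add z z' hz hz' => rw [map_add, add_mul, hz, hz', TensorProduct.add_tmul, map_add]
    | tmul u v => simp
  have h₂₃ (u : F) (z : F ⊗[R] F) : (u ⊗ₜ[R] (1 : F ⊗[R] F)) *
      productMap (includeRight.comp includeLeft) (includeRight.comp includeRight) z =
        u ⊗ₜ[R] z := by
    induction z with
    | zero => simp
    | add z z' hz hz' => rw [map_add, mul_add, hz, hz', TensorProduct.tmul_add]
    | tmul v v' => simp
  calc
    _ = _ := by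
      rw [← AlgHom.comp_assoc]
      exact congrArg (AlgHom.comp · Δ) (Algebra.TensorProduct.ext' fun u v => (h₁₂ (Δ u) v).symm)
    _ = _ := h
    _ = _ := by
      refine congrArg (AlgHom.comp · Δ) (Algebra.TensorProduct.ext' fun u v => ?_)
      exact h₂₃ u (Δ v)

end

section Bialgebra

open Algebra.TensorProduct

variable {A : Type u} {B : Type v} [CommSemiring B] [Algebra ℝ B]

theorem productMap_coproduct_treeForest (α β : ForestAlgebra A →ₐ[ℝ] B) (t : PTree A) :
    productMap α β (coproduct (treeForest (RTree.mk t))) =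
      t.extractionSum (fun τ => α (treeForest τ)) fun r c =>
        α (treeForest (RTree.mk r)) * β (treeForest (RTree.mk c)) := by
  rw [coproduct_treeForest, map_sum, PTree.extractionSum]
  refine Finset.sum_congr rfl fun σ _ => ?_
  rw [productMap_apply_tmul, PTree.subforest, PTree.components, Multiset.map_cons,
    Multiset.prod_cons, map_mul, map_multiset_prod, Multiset.map_map, Function.comp_def,
    mul_right_comm, mul_comm]

theorem productMap_coproduct_assoc (α β γ : ForestAlgebra A →ₐ[ℝ] B) :
    (productMap ((productMap α β).comp coproduct) γ).comp coproduct =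
      (productMap α ((productMap β γ).comp coproduct)).comp coproduct := by
  refine algHom_ext_treeForest fun t => ?_
  have h := PTree.extractionSum_assoc (fun τ => α (treeForest τ)) (fun τ => β (treeForest τ))
    (fun p q c => α (treeForest (RTree.mk p)) *
      (β (treeForest (RTree.mk q)) * γ (treeForest (RTree.mk c))))
    (z := fun τ => productMap α β (coproduct (treeForest τ)))
    (productMap_coproduct_treeForest α β) t
  simpa only [AlgHom.comp_apply, productMap_coproduct_treeForest, PTree.extractionSum_mul,
    PTree.mul_extractionSum, mul_assoc] using h

theorem coproduct_coassoc :
    (Algebra.TensorProduct.assoc ℝ ℝ ℝ (ForestAlgebra A) (ForestAlgebra A)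
      (ForestAlgebra A)).toAlgHom.comp
        ((Algebra.TensorProduct.map coproduct (.id ℝ (ForestAlgebra A))).comp coproduct) =
      (Algebra.TensorProduct.map (.id ℝ (ForestAlgebra A)) coproduct).comp coproduct :=
  coassoc_of_productMap_assoc coproduct (productMap_coproduct_assoc _ _ _)

theorem counit_rTensor_coproduct :
    (Algebra.TensorProduct.map counit (.id ℝ (ForestAlgebra A))).comp coproduct =
      (Algebra.TensorProduct.lid ℝ (ForestAlgebra A)).symm := by
  refine algHom_ext_treeForest fun t => ?_
  change _ = (1 : ℝ) ⊗ₜ[ℝ] treeForest (RTree.mk t)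
  rw [AlgHom.comp_apply, coproduct_treeForest, map_sum, Fintype.sum_eq_single ⊥ fun σ hσ => by
    rw [Algebra.TensorProduct.map_tmul, PTree.counit_subforest_of_ne_bot hσ,
      TensorProduct.zero_tmul],
    Algebra.TensorProduct.map_tmul, PTree.subforest_bot, PTree.contract_bot, map_one,
    AlgHom.id_apply]

theorem counit_lTensor_coproduct :
    (Algebra.TensorProduct.map (.id ℝ (ForestAlgebra A)) counit).comp coproduct =
      (Algebra.TensorProduct.rid ℝ ℝ (ForestAlgebra A)).symm := by
  refine algHom_ext_treeForest fun t => ?_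
  change _ = treeForest (RTree.mk t) ⊗ₜ[ℝ] (1 : ℝ)
  rw [AlgHom.comp_apply, coproduct_treeForest, map_sum, Fintype.sum_eq_single ⊤ fun σ hσ => by
    rw [Algebra.TensorProduct.map_tmul, counit_treeForest_of_ne_one
      (RTree.mk_eq_one_iff.not.2 (PTree.contract_eq_nil_iff.not.2 hσ)), TensorProduct.tmul_zero],
    Algebra.TensorProduct.map_tmul, PTree.subforest_top, PTree.contract_eq_nil_iff.2 rfl,
    RTree.mk_nil, treeForest_one, map_one, AlgHom.id_apply]

end Bialgebra

section HopfAlgebra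

open WithConv

variable {A : Type u}

/-- The forest algebra with the extraction-contraction coproduct. As an additive monoid algebra, the
polynomial algebra `ForestAlgebra A` also has a bialgebra structure with grouplike monomials, which
this local instance overrides. -/
@[reducible]
noncomputable def extractionBialgebra (A : Type u) : Bialgebra ℝ (ForestAlgebra A) :=
  .ofAlgHom coproduct counit coproduct_coassoc counit_rTensor_coproduct counit_lTensor_coproduct

/-- The coalgebra underlying `extractionBialgebra`; as a local instance of its own, it takes
precedence over the coalgebra structure with grouplike monomials. -/
@[reducible]
noncomputable def extractionCoalgebra (A : Type u) : Coalgebra ℝ (ForestAlgebra A) :=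
  (extractionBialgebra A).toCoalgebra

attribute [local instance] extractionBialgebra extractionCoalgebra

/-- The antipode on trees, defined by recursion on the number of edges so that
`∑ σ, subforest t σ * antipodeTree (contract t σ)` is the counit: the term `σ = ⊥` of this sum is
`antipodeTree t` itself. -/
noncomputable def antipodeTree (τ : RTree A) : ForestAlgebra A :=
  algebraMap ℝ _ (counit (treeForest τ)) -
    ∑ σ : {σ : τ.out.EdgeSet // σ ≠ ⊥},
      τ.out.subforest σ * antipodeTree (RTree.mk (τ.out.contract σ))
termination_by τ.size
decreasing_by
  calc (τ.out.contract σ).size < τ.out.size := PTree.size_contract_lt σ.2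
    _ = τ.size := congrArg RTree.size τ.out_eq

theorem sum_subforest_mul_antipodeTree (τ : RTree A) :
    ∑ σ : τ.out.EdgeSet, τ.out.subforest σ * antipodeTree (RTree.mk (τ.out.contract σ)) =
      algebraMap ℝ _ (counit (treeForest τ)) := by
  have hτ : RTree.mk τ.out = τ := τ.out_eq
  rw [Fintype.sum_eq_add_sum_subtype_ne _ ⊥, PTree.subforest_bot, PTree.contract_bot, one_mul, hτ]
  nth_rw 1 [antipodeTree]
  exact sub_add_cancel _ _

theorem antipodeTree_one : antipodeTree (1 : RTree A) = 1 := by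
  have hnil : (1 : RTree A).out = PTree.nil := RTree.mk_eq_one_iff.1 (Quotient.out_eq _)
  have : IsEmpty {σ : (1 : RTree A).out.EdgeSet // σ ≠ ⊥} := by
    rw [hnil]
    exact ⟨fun σ => σ.2 (funext fun e => nomatch e)⟩
  rw [antipodeTree, treeForest_one, map_one, map_one, Fintype.sum_empty, sub_zero]

/-- The antipode of the forest algebra, the algebra morphism which extends `antipodeTree`. -/
noncomputable def antipode : ForestAlgebra A →ₐ[ℝ] ForestAlgebra A :=
  MvPolynomial.aeval fun τ => antipodeTree τ.1

theorem productMap_id_antipode :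
    (Algebra.TensorProduct.productMap (.id ℝ _) antipode).comp coproduct =
      (Algebra.ofId ℝ (ForestAlgebra A)).comp counit := by
  refine algHom_ext_treeForest fun t => ?_
  obtain ⟨τ, hτ⟩ : ∃ τ, τ = RTree.mk t := ⟨_, rfl⟩
  have hout : RTree.mk τ.out = τ := τ.out_eq
  rw [← hτ, ← hout, AlgHom.comp_apply, coproduct_treeForest, map_sum]
  simp only [Algebra.TensorProduct.productMap_apply_tmul, AlgHom.id_apply, antipode,
    aeval_treeForest antipodeTree_one, sum_subforest_mul_antipodeTree, hout]
  rfl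

theorem toConv_mul_toConv {B : Type v} [CommSemiring B] [Algebra ℝ B] (α β : ForestAlgebra A →ₐ[ℝ] B) :
    toConv α * toConv β = toConv ((Algebra.TensorProduct.productMap α β).comp coproduct) := by
  rw [Algebra.TensorProduct.productMap_eq_comp_map]
  rfl

theorem id_mul_toConv_antipode :
    (toConv (.id ℝ _) * toConv antipode : WithConv (ForestAlgebra A →ₐ[ℝ] ForestAlgebra A)) =
      1 := by
  rw [toConv_mul_toConv, productMap_id_antipode]
  rfl

theorem toConv_antipode_mul_id :
    (toConv antipode * toConv (.id ℝ _) : WithConv (ForestAlgebra A →ₐ[ℝ] ForestAlgebra A)) =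
      1 := by
  -- `antipode` has the left inverse `id` and the right inverse `antipode.comp antipode`.
  have hright : toConv antipode * toConv (antipode.comp antipode) =
      (1 : WithConv (ForestAlgebra A →ₐ[ℝ] ForestAlgebra A)) := by
    have hcomp := AlgHom.comp_convMul_distrib (antipode (A := A)) (toConv (.id ℝ _))
      (toConv antipode)
    rw [id_mul_toConv_antipode] at hcomp
    refine Eq.trans (WithConv.ext hcomp.symm) (WithConv.ext (AlgHom.ext fun x => ?_))
    exact antipode.commutes _
  rw [left_inv_eq_right_inv id_mul_toConv_antipode hright]
  exact hright

/-- The Hopf algebra structure of `extractionBialgebra`, through which the characters form a group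
under convolution. -/
@[reducible]
noncomputable def extractionHopfAlgebra (A : Type u) : HopfAlgebra ℝ (ForestAlgebra A) :=
  .ofAlgHom antipode (by
    rw [← WithConv.toConv_injective.eq_iff]
    refine Eq.trans ?_ toConv_antipode_mul_id
    rw [toConv_mul_toConv]
    rfl) productMap_id_antipode

attribute [local instance] extractionHopfAlgebra

theorem isConvInverse_iff (α β : ForestAlgebra A →ₗ[ℝ] ℝ) :
    IsConvInverse α β ↔ toConv α * toConv β = 1 ∧ toConv β * toConv α = 1 := by
  rw [WithConv.ext_iff, WithConv.ext_iff]
  rfl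

theorem toConv_inv (μ : ForestAlgebra A →ₐ[ℝ] ℝ) :
    (toConv μ)⁻¹ = toConv (μ.comp antipode) := rfl

theorem isConvInverse_toLinearMap_iff (α : ForestAlgebra A →ₗ[ℝ] ℝ)
    (μ : ForestAlgebra A →ₐ[ℝ] ℝ) :
    IsConvInverse α μ.toLinearMap ↔ α = (μ.comp antipode).toLinearMap := by
  have hl : toConv (μ.comp antipode).toLinearMap * toConv μ.toLinearMap = 1 := by
    rw [← AlgHom.toLinearMap_convOne, ← inv_mul_cancel (toConv μ), toConv_inv,
      AlgHom.toLinearMap_convMul]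
  have hr : toConv μ.toLinearMap * toConv (μ.comp antipode).toLinearMap = 1 := by
    rw [← AlgHom.toLinearMap_convOne, ← mul_inv_cancel (toConv μ), toConv_inv,
      AlgHom.toLinearMap_convMul]
  rw [isConvInverse_iff]
  constructor
  · rintro ⟨h, -⟩
    exact toConv_injective (left_inv_eq_right_inv h hr)
  · rintro rfl
    exact ⟨hl, hr⟩

theorem coproduct_embed (c : TreeSpace A) :
    coproduct (embed c) = embed.lTensor (ForestAlgebra A) (coaction c) := by
  suffices h : coproduct.toLinearMap ∘ₗ embed = embed.lTensor (ForestAlgebra A) ∘ₗ coaction from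
    LinearMap.congr_fun h c
  refine Finsupp.lhom_ext' fun τ => LinearMap.ext_ring ?_
  obtain ⟨t, rfl⟩ : ∃ t, τ = RTree.mk t := τ.exists_rep.imp fun _ => Eq.symm
  have hext : coaction (Finsupp.single (RTree.mk t) 1) = t.extract := by
    rw [coaction, Finsupp.linearCombination_single, one_smul]
    rfl
  simp only [LinearMap.comp_apply, Finsupp.lsingle_apply, AlgHom.toLinearMap_apply, embed_single,
    coproduct_treeForest, hext, PTree.extract, map_sum, LinearMap.lTensor_tmul]

theorem apply_embed_psi (α β : ForestAlgebra A →ₗ[ℝ] ℝ) (c : TreeSpace A) :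
    β (embed (psi α c)) = conv α β (embed c) := by
  have hz (z : ForestAlgebra A ⊗[ℝ] TreeSpace A) :
      β (embed (TensorProduct.lid ℝ _ (α.rTensor _ z))) =
        LinearMap.mul' ℝ ℝ (TensorProduct.map α β (embed.lTensor _ z)) := by
    induction z with
    | zero => simp only [map_zero]
    | add z z' hz hz' => simp only [map_add, hz, hz']
    | tmul x c => simp
  simp only [conv, LinearMap.comp_apply, AlgHom.toLinearMap_apply, coproduct_embed]
  exact hz _

theorem eq_counit_iff {α : ForestAlgebra A →ₐ[ℝ] ℝ} :
    α = counit ↔ ∀ τ : RTree A, τ ≠ 1 → α (treeForest τ) = 0 := by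
  constructor
  · rintro rfl τ hτ
    exact counit_treeForest_of_ne_one hτ
  · refine fun h => algHom_ext_treeForest fun t => ?_
    by_cases ht : RTree.mk t = 1
    · rw [ht, treeForest_one, map_one, map_one]
    · rw [h _ ht, counit_treeForest_of_ne_one ht]

theorem apply_embed_psi_single_eq_zero_iff (μ ℓ : ForestAlgebra A →ₐ[ℝ] ℝ) :
    (∀ τ : RTree A, τ ≠ 1 → μ (embed (psi ℓ.toLinearMap (Finsupp.single τ 1))) = 0) ↔
      ℓ = μ.comp antipode := by
  have hconv (τ : RTree A) : μ (embed (psi ℓ.toLinearMap (Finsupp.single τ 1))) =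
      (toConv ℓ * toConv μ).ofConv (treeForest τ) := by
    rw [← embed_single]
    exact apply_embed_psi ℓ.toLinearMap μ.toLinearMap _
  calc
    _ ↔ (toConv ℓ * toConv μ).ofConv = counit := by simp only [hconv, eq_counit_iff]
    _ ↔ toConv ℓ * toConv μ = 1 := (WithConv.ext_iff (y := 1)).symm
    _ ↔ toConv ℓ = (toConv μ)⁻¹ := mul_eq_one_iff_eq_inv
    _ ↔ ℓ = μ.comp antipode := WithConv.ext_iff

end HopfAlgebra

section Moments

variable {A : Type u} {d : ℕ} {Ω : Type*} [MeasurableSpace Ω] {P : Measure Ω}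
  {X : Ω → PlantedTree A → C(Space d, ℝ)}

theorem HasFiniteMoments.memLp (hmom : HasFiniteMoments X P) (hX : Measurable X)
    (τ : PlantedTree A) (p : ℕ) : MemLp (fun ω => X ω τ 0) p P := by
  have hm : Measurable fun ω => X ω τ 0 :=
    (ContinuousEvalConst.continuous_eval_const (0 : Space d)).measurable.comp
      (measurable_pi_iff.1 hX τ)
  rcases eq_or_ne p 0 with rfl | hp
  · rw [Nat.cast_zero, memLp_zero_iff_aestronglyMeasurable]
    exact hm.aestronglyMeasurable
  · rw [← integrable_norm_rpow_iff hm.aestronglyMeasurable (Nat.cast_ne_zero.2 hp)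
      (ENNReal.natCast_ne_top p)]
    simpa only [ENNReal.toReal_natCast, Real.rpow_natCast, Real.norm_eq_abs] using hmom τ p

theorem liftC_apply_zero (Φ : PlantedTree A → C(Space d, ℝ)) (c : TreeSpace A) :
    liftC Φ c 0 = ∑ τ ∈ c.support, c τ * canonicalLift Φ τ 0 := by
  simp [liftC, Finsupp.linearCombination_apply, Finsupp.sum, ContinuousMap.sum_apply]

variable [IsProbabilityMeasure P]

theorem meanChar_embed (c : TreeSpace A) : meanChar X P (embed c) = mean X P c := by
  suffices h : (meanChar X P).toLinearMap ∘ₗ embed = mean X P from LinearMap.congr_fun h c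
  refine Finsupp.lhom_ext' fun τ => LinearMap.ext_ring ?_
  have hone : mean X P (Finsupp.single 1 1) = 1 := by simp [mean]
  simp only [LinearMap.comp_apply, Finsupp.lsingle_apply, AlgHom.toLinearMap_apply, embed_single]
  exact aeval_treeForest (f := fun τ => mean X P (Finsupp.single τ 1)) hone τ

theorem eq_meanChar_iff (ν : ForestAlgebra A →ₐ[ℝ] ℝ) :
    (∀ c : TreeSpace A, ν (embed c) = mean X P c) ↔ ν = meanChar X P := by
  refine ⟨fun h => algHom_ext_treeForest fun t => ?_, ?_⟩
  · rw [← embed_single, h, meanChar_embed]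
  · rintro rfl
    exact meanChar_embed

variable (hX : ∀ (τ : PlantedTree A) (p : ℕ), MemLp (fun ω => X ω τ 0) p P)

include hX

theorem memLp_canonicalLift (t : PTree A) (p : ℕ) :
    MemLp (fun ω => canonicalLift (X ω) (RTree.mk t) 0) p P := by
  induction t generalizing p with
  | nil => exact memLp_const (1 : ℝ)
  | graft a t s _ ih =>
    -- Cauchy–Schwarz
    have : ENNReal.HolderTriple ((2 * p : ℕ) : ENNReal) ((2 * p : ℕ) : ENNReal) p := ⟨by
      rw [Nat.cast_mul, ENNReal.mul_inv (by simp) (by simp), ← add_mul]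
      simp [ENNReal.inv_two_add_inv_two]⟩
    exact (ih (2 * p)).mul' (hX ⟨RTree.plant a (RTree.mk t), a, RTree.mk t, rfl⟩ (2 * p))

theorem integrable_canonicalLift (τ : RTree A) :
    Integrable (fun ω => canonicalLift (X ω) τ 0) P := by
  obtain ⟨t⟩ := τ
  exact memLp_one_iff_integrable.1 (mod_cast memLp_canonicalLift hX t 1)

theorem integrable_liftC (c : TreeSpace A) : Integrable (fun ω => liftC (X ω) c 0) P := by
  simp only [liftC_apply_zero]
  exact integrable_finsetSum _ fun τ _ => (integrable_canonicalLift hX τ).const_mul _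

theorem integral_liftC (c : TreeSpace A) : ∫ ω, liftC (X ω) c 0 ∂P = mean X P c := by
  simp only [liftC_apply_zero]
  rw [integral_finsetSum _ fun τ _ => (integrable_canonicalLift hX τ).const_mul _]
  simp only [integral_const_mul, mean, Finsupp.linearCombination_apply, Finsupp.sum, smul_eq_mul]

end Moments

end WickTrees

theorem theorem9p1_general {A : Type*} {d : ℕ} {Ω : Type*} [MeasurableSpace Ω] (P : Measure Ω)
    [IsProbabilityMeasure P] (X : Ω → PlantedTree A → C(Space d, ℝ))
    (hX : ∀ (τ : PlantedTree A) (p : ℕ), MemLp (fun ω => X ω τ 0) p P) :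
    (∀ c : TreeSpace A, Integrable (fun ω => liftC (X ω) c 0) P) ∧
    (∀ ν : ForestAlgebra A →ₐ[ℝ] ℝ,
      (∀ c : TreeSpace A, ν (embed c) = mean X P c) ↔ ν = meanChar X P) ∧
    ∃ μinv : ForestAlgebra A →ₐ[ℝ] ℝ,
      (∀ α : ForestAlgebra A →ₗ[ℝ] ℝ,
        IsConvInverse α (meanChar X P).toLinearMap ↔ α = μinv.toLinearMap) ∧
      ∀ ℓ : ForestAlgebra A →ₐ[ℝ] ℝ,
        (∀ τ : RTree A, τ ≠ 1 →
          ∫ ω, liftC (X ω) (psi ℓ.toLinearMap (Finsupp.single τ 1)) 0 ∂P = 0) ↔ ℓ = μinv := by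
  refine ⟨integrable_liftC hX, eq_meanChar_iff, (meanChar X P).comp antipode,
    fun α => isConvInverse_toLinearMap_iff α _, fun ℓ => ?_⟩
  simp only [integral_liftC hX, ← meanChar_embed]
  exact apply_embed_psi_single_eq_zero_iff _ _

theorem theorem9p1 (m d : ℕ) {Ω : Type*} [MeasurableSpace Ω] (P : Measure Ω)
    [IsProbabilityMeasure P] (X : Ω → PlantedTree (Fin m) → C(Space d, ℝ))
    (hX : Measurable X) (hstat : IsStationaryFamily X P) (hmom : HasFiniteMoments X P) :
    -- all the expectations below are well defined
    (∀ c : TreeSpace (Fin m), Integrable (fun ω => liftC (X ω) c 0) P) ∧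
    -- `meanChar X P` is the unique character which extends `mean X P`
    (∀ ν : ForestAlgebra (Fin m) →ₐ[ℝ] ℝ,
      (∀ c : TreeSpace (Fin m), ν (embed c) = mean X P c) ↔ ν = meanChar X P) ∧
    -- it has exactly one convolution inverse, which is a character and the only centring one
    ∃ μinv : ForestAlgebra (Fin m) →ₐ[ℝ] ℝ,
      (∀ α : ForestAlgebra (Fin m) →ₗ[ℝ] ℝ,
        IsConvInverse α (meanChar X P).toLinearMap ↔ α = μinv.toLinearMap) ∧
      ∀ ℓ : ForestAlgebra (Fin m) →ₐ[ℝ] ℝ,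
        (∀ τ : RTree (Fin m), τ ≠ 1 →
          ∫ ω, liftC (X ω) (psi ℓ.toLinearMap (Finsupp.single τ 1)) 0 ∂P = 0) ↔ ℓ = μinv := by
  exact theorem9p1_general P X (hmom.memLp hX)
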